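/- Let $\mathfrak c$ be the cardinality of $\mathbb R$; "measurable" means Lebesgue measurable. For $F\colon\mathbb R^2\to\mathbb R$ and $f\colon\mathbb R\to\mathbb R$ put $F_f(x)=F(x,f(x))$. The function $F$ is \emph{sup-measurable} if $F_f$ is measurable for every measurable $f\colon\mathbb R\to\mathbb R$, and \emph{weakly sup-measurable} if $F_f$ is measurable for every continuous, almost everywhere differentiable $f\colon\mathbb R\to\mathbb R$. A subset $A$ of a commutative algebra is \emph{strongly $\kappa$-algebrable} if $A\cup\{0\}$ contains a (not necessarily unital) subalgebra which is free as a commutative algebra on a set of $\kappa$ generators, that is, a subalgebra generated by a set $X$ of cardinality $\kappa$ such that $P(x_1,\dots,x_k)\neq 0$ for all $k\ge 1$, all distinct $x_1,\dots,x_k\in X$ and every non-zero polynomial $P$ in $k$ variables without constant term. Assume the following condition. (A) There is a function $f\colon\mathbb R\to\mathbb R$ whose graph is the union of a family $\{f_\alpha\colon\alpha<\mathfrak c\}$ of pairwise disjoint (graphs of) partial functions, each of positive Lebesgue outer measure in $\mathbb R^2$, such that $\{x\in\mathbb R\colon f(x)=g(x)\}$ is a null set for every continuous $g\colon\mathbb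 R\to\mathbb R$. Then the family of all weakly sup-measurable functions $F\colon\mathbb R^2\to\mathbb R$ that are neither sup-measurable nor measurable is strongly $2^{\mathfrak c}$-algebrable in the real algebra $\mathbb R^{\mathbb R^2}$ of all functions $\mathbb R^2\to\mathbb R$ with pointwise operations. -/

import Mathlib

open MeasureTheory
open scoped Cardinal

/-- The free commutative (not necessarily unital) `K`-algebra on a set `σ` of generators:
the polynomials over `K` in the variables `σ` without constant term. -/
def freeCommAlgebra (K σ : Type*) [Field K] : NonUnitalSubalgebra K (MvPolynomial σ K) where
  carrier := {P | MvPolynomial.constantCoeff P = 0}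
  add_mem' := by
    intro P Q hP hQ
    simp only [Set.mem_ofPred_eq] at hP hQ ⊢
    rw [map_add, hP, hQ, add_zero]
  zero_mem' := by simp
  mul_mem' := by
    intro P Q hP hQ
    simp only [Set.mem_ofPred_eq] at hP hQ ⊢
    rw [map_mul, hP, zero_mul]
  smul_mem' := by
    intro c P hP
    simp only [Set.mem_ofPred_eq] at hP ⊢
    rw [MvPolynomial.smul_eq_C_mul, map_mul, hP, mul_zero]

/-- The free generators of `freeCommAlgebra K σ`. -/
noncomputable def freeCommAlgebra.gen (K : Type*) {σ : Type*} [Field K] (i : σ) :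
    freeCommAlgebra K σ :=
  ⟨MvPolynomial.X i, MvPolynomial.constantCoeff_X K i⟩

/-- A subset `A` of a commutative `K`-algebra `L` is strongly `κ`-algebrable if `A ∪ {0}` contains
a (not necessarily unital) subalgebra which is generated by a set `X` of cardinality `κ` and is
isomorphic to a free algebra, with `X` as a set of free generators. -/
def StronglyAlgebrable (K : Type*) {L : Type*} [Field K] [CommRing L] [Algebra K L]
    (κ : Cardinal) (A : Set L) : Prop :=
  ∃ B : NonUnitalSubalgebra K L, (B : Set L) ⊆ A ∪ {0} ∧
    ∃ X : Set L, #X = κ ∧ NonUnitalAlgebra.adjoin K X = B ∧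
      ∃ e : freeCommAlgebra K X →ₙₐ[K] B, Function.Bijective e ∧
        ∀ x : X, (e (freeCommAlgebra.gen K x) : L) = x

/-- Lebesgue measurability of a real function (on `ℝ` or on `ℝ × ℝ`): preimages of Borel sets
belong to the completion of the Borel σ-algebra with respect to Lebesgue measure. -/
def LebesgueMeasurable {α : Type*} [MeasureSpace α] (f : α → ℝ) : Prop :=
  NullMeasurable f (volume : Measure α)

/-- The Carathéodory superposition `F_f (x) = F (x, f x)`. -/
def caratheodorySuperposition (F : ℝ × ℝ → ℝ) (f : ℝ → ℝ) : ℝ → ℝ :=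
  fun x => F (x, f x)

/-- `F` is sup-measurable. -/
def SupMeasurable (F : ℝ × ℝ → ℝ) : Prop :=
  ∀ f : ℝ → ℝ, LebesgueMeasurable f → LebesgueMeasurable (caratheodorySuperposition F f)

/-- `F` is weakly sup-measurable. -/
def WeaklySupMeasurable (F : ℝ × ℝ → ℝ) : Prop :=
  ∀ f : ℝ → ℝ, Continuous f → (∀ᵐ x : ℝ, DifferentiableAt ℝ f x) →
    LebesgueMeasurable (caratheodorySuperposition F f)

/-- Condition (A): some `f : ℝ → ℝ` agrees with each continuous function only on a null set, and
its graph is the union of `𝔠` many pairwise disjoint sets (graphs of partial functions), each of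
positive planar Lebesgue outer measure. (On an arbitrary set, `volume` is the outer measure.) -/
def ConditionA : Prop :=
  ∃ (f : ℝ → ℝ) (ι : Type) (G : ι → Set (ℝ × ℝ)),
    #ι = 𝔠 ∧
    Pairwise (fun α β => Disjoint (G α) (G β)) ∧
    (⋃ α, G α) = {p : ℝ × ℝ | p.2 = f p.1} ∧
    (∀ α, 0 < volume (G α)) ∧
    ∀ g : ℝ → ℝ, Continuous g → volume {x : ℝ | f x = g x} = 0

/-!
A superposition only tests a function `F` on the plane along a single graph. Choose a Borel function
`φ` so rough that it differs almost everywhere from every continuous, almost everywhere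
differentiable function, and a set `N ⊆ ℝ` such that neither `N` nor its complement contains a
measurable set of positive measure. If `F` lives on the graphs of `φ`, `φ + 1` and `f`, then
superpositions with continuous, almost everywhere differentiable functions vanish almost everywhere.
Let `F (x, y) = h x` on the graph of `φ` over `N`, on the graph of `φ + 1` off `N` and on the graph
of `f`. The superpositions of `F` with `φ` and `φ + 1` are then `h` cut down to `N` and to its
complement, and cannot both be measurable unless `h = 0` almost everywhere. The graph of `f` keeps
`F` itself from being measurable: by Fubini, a measurable function supported on countably many
graphs vanishes almost everywhere.

Letting `h` be constant on each of the continuum many pieces of the graph of `f`, it remains to find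
`2 ^ 𝔠` algebraically independent real functions on a set of cardinality `𝔠`. Such are the
evaluation maps at the points of `ℝ ^ ℝ`, on the set of real polynomials in continuum many
variables.

The rough function is the series `∑ (3 / 4) ^ k * dₖ x` over the binary digits of `x`. Moving `x` by
`2⁻ᵏ` in the suitable direction changes only the `k`-th digit, hence the value by
`(3 / 4) ^ k ≫ 2⁻ᵏ`; but a set of positive measure on which the function is Lipschitz would contain
points `x - δ`, `x`, `x + δ` for all small `δ`.
-/

section Algebra

open MvPolynomial

variable {K : Type*} [Field K]

theorem adjoin_range_X (K σ : Type*) [Field K] :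
    NonUnitalAlgebra.adjoin K (Set.range (X : σ → MvPolynomial σ K)) = freeCommAlgebra K σ := by
  refine le_antisymm (NonUnitalAlgebra.adjoin_le ?_) fun P hP => ?_
  · rintro _ ⟨i, rfl⟩
    exact constantCoeff_X K i
  · suffices h : ∀ Q : MvPolynomial σ K, Q - C (constantCoeff Q) ∈
        NonUnitalAlgebra.adjoin K (Set.range (X : σ → MvPolynomial σ K)) by
      simpa only [show constantCoeff P = 0 from hP, map_zero, sub_zero] using h P
    intro Q
    induction Q using MvPolynomial.induction_on with
    | C a => simp only [constantCoeff_C, sub_self, zero_mem]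
    | add Q R hQ hR =>
      rw [map_add, map_add, add_sub_add_comm]
      exact add_mem hQ hR
    | mul_X Q i hQ =>
      have hX : X i ∈ NonUnitalAlgebra.adjoin K (Set.range (X : σ → MvPolynomial σ K)) :=
        NonUnitalAlgebra.subset_adjoin K (Set.mem_range_self i)
      have hsplit : Q * X i - C (constantCoeff (Q * X i)) =
          (Q - C (constantCoeff Q)) * X i + constantCoeff Q • X i := by
        simp only [map_mul, constantCoeff_X, mul_zero, map_zero, sub_zero, smul_eq_C_mul]
        ring
      rw [hsplit]
      exact add_mem (mul_mem hQ hX) (SMulMemClass.smul_mem _ hX)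

theorem map_aeval_freeCommAlgebra {L σ : Type*} [CommRing L] [Algebra K L] (x : σ → L) :
    (freeCommAlgebra K σ).map (aeval x : MvPolynomial σ K →ₐ[K] L) =
      NonUnitalAlgebra.adjoin K (Set.range x) := by
  rw [← adjoin_range_X, NonUnitalAlgHom.map_adjoin, ← Set.range_comp]
  congr 2
  exact funext fun i => aeval_X x i

theorem StronglyAlgebrable.of_aeval_coe_mem {L : Type*} [CommRing L] [Algebra K L] {A Y : Set L}
    (hA : 0 ∉ A)
    (hY : ∀ P : MvPolynomial Y K, P ≠ 0 → constantCoeff P = 0 → aeval ((↑) : Y → L) P ∈ A) :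
    StronglyAlgebrable K #Y A := by
  let evalY : MvPolynomial Y K →ₐ[K] L := aeval (↑)
  have hmap : (freeCommAlgebra K Y).map evalY = NonUnitalAlgebra.adjoin K Y := by
    rw [map_aeval_freeCommAlgebra, Subtype.range_coe]
  have hmem (P : freeCommAlgebra K Y) : evalY P ∈ NonUnitalAlgebra.adjoin K Y :=
    hmap ▸ ⟨P, P.2, rfl⟩
  let e : freeCommAlgebra K Y →ₙₐ[K] NonUnitalAlgebra.adjoin K Y :=
    NonUnitalAlgHom.codRestrict ((evalY : MvPolynomial Y K →ₙₐ[K] L).comp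
      (NonUnitalSubalgebraClass.subtype (freeCommAlgebra K Y))) _ hmem
  refine ⟨_, fun y hy => ?_, Y, rfl, rfl, e, ⟨?_, fun ⟨y, hy⟩ => ?_⟩, fun y => aeval_X _ y⟩
  · obtain ⟨P, hP, rfl⟩ := hmap.symm ▸ hy
    rcases eq_or_ne P 0 with rfl | hP0
    · exact Or.inr (map_zero evalY)
    · exact Or.inl (hY P hP0 hP)
  · refine (injective_iff_map_eq_zero e).2 fun P hP => by_contra fun hP0 => hA ?_
    have heval : evalY P = 0 := congrArg Subtype.val hP
    exact heval ▸ hY P (fun h => hP0 (Subtype.ext h)) P.2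
  · obtain ⟨P, hP, hPy⟩ := hmap.symm ▸ hy
    exact ⟨⟨P, hP⟩, Subtype.ext hPy⟩

universe u in
theorem StronglyAlgebrable.of_aeval_mem {L σ : Type u} [CommRing L] [Algebra K L] {A : Set L}
    (hA : 0 ∉ A) (x : σ → L)
    (hx : ∀ P : MvPolynomial σ K, P ≠ 0 → constantCoeff P = 0 → aeval x P ∈ A) :
    StronglyAlgebrable K #σ A := by
  have hinj : Function.Injective x := by
    intro i j hij
    by_contra hne
    have hmem := hx (X i - X j) (sub_ne_zero.2 fun h => hne (X_injective h))
      (by simp only [map_sub, constantCoeff_X, sub_self])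
    rw [map_sub, aeval_X, aeval_X, hij, sub_self] at hmem
    exact hA hmem
  rw [← Cardinal.mk_range_eq x hinj]
  refine .of_aeval_coe_mem hA fun P hP hP0 => ?_
  let index : Set.range x ≃ σ := (Equiv.ofInjective x hinj).symm
  have hcomp : x ∘ index = (↑) := funext (Equiv.apply_ofInjective_symm hinj)
  rw [← hcomp, ← aeval_rename]
  refine hx _ ((map_ne_zero_iff _ (rename_injective _ index.injective)).2 hP) ?_
  rw [constantCoeff_rename, hP0]

theorem aeval_pi_apply {R σ α : Type*} [CommSemiring R] (x : σ → α → R) (P : MvPolynomial σ R)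
    (a : α) : aeval x P a = eval (fun i => x i a) P :=
  comp_aeval_apply x (Pi.evalAlgHom R (fun _ : α => R) a) P

theorem aeval_pi_comp {R σ α β : Type*} [CommSemiring R] (x : σ → α → R) (g : β → α)
    (P : MvPolynomial σ R) : aeval (fun i => x i ∘ g) P = aeval x P ∘ g := by
  ext b
  simp only [aeval_pi_apply, Function.comp_apply]

theorem aeval_indicator {R σ α : Type*} [CommSemiring R] (T : Set α) (x : σ → α → R)
    {P : MvPolynomial σ R} (hP : constantCoeff P = 0) :
    aeval (fun i => T.indicator (x i)) P = T.indicator (aeval x P) := by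
  ext a
  by_cases ha : a ∈ T
  · simp only [aeval_pi_apply, Set.indicator_of_mem ha]
  · simp only [aeval_pi_apply, Set.indicator_of_notMem ha, eval_zero', hP]

theorem exists_eval_ne_zero_of_notMem {σ : Type*} {J : Finset (σ → K)} {v : σ → K} (hv : v ∉ J) :
    ∃ q : MvPolynomial σ K, eval v q ≠ 0 ∧ ∀ w ∈ J, eval w q = 0 := by
  have hsep : ∀ w ∈ J, ∃ l : MvPolynomial σ K, eval v l ≠ 0 ∧ eval w l = 0 := by
    intro w hw
    obtain ⟨i, hi⟩ := Function.ne_iff.1 (show v ≠ w from fun h => hv (h ▸ hw))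
    refine ⟨X i - C (w i), ?_, ?_⟩
    · simpa only [map_sub, eval_X, eval_C, sub_ne_zero] using hi
    · simp only [map_sub, eval_X, eval_C, sub_self]
  choose! l hlv hlw using hsep
  refine ⟨∏ w ∈ J, l w, ?_, fun w hw => ?_⟩
  · rw [map_prod]
    exact Finset.prod_ne_zero_iff.2 hlv
  · rw [map_prod]
    exact Finset.prod_eq_zero hw (hlw w hw)

theorem exists_eval_eq_on_finset {σ : Type*} (J : Finset (σ → K)) (t : (σ → K) → K) :
    ∃ q : MvPolynomial σ K, ∀ v ∈ J, eval v q = t v := by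
  classical
  induction J using Finset.induction with
  | empty => exact ⟨0, fun v hv => absurd hv (Finset.notMem_empty v)⟩
  | insert v J hv ih =>
    obtain ⟨q, hq⟩ := ih
    obtain ⟨b, hbv, hbJ⟩ := exists_eval_ne_zero_of_notMem hv
    refine ⟨q + C ((t v - eval v q) / eval v b) * b, (Finset.forall_mem_insert ..).2 ⟨?_, ?_⟩⟩
    · rw [map_add, map_mul, eval_C, div_mul_cancel₀ _ hbv, add_sub_cancel]
    · intro w hw
      rw [map_add, map_mul, hbJ w hw, mul_zero, add_zero, hq w hw]

/-- The evaluation maps at finitely many points take arbitrary values simultaneously, so a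
polynomial relation between them would hold at every point of `K ^ m`. -/
theorem algebraicIndependent_eval (K σ : Type*) [Field K] [Infinite K] :
    AlgebraicIndependent K fun (v : σ → K) (q : MvPolynomial σ K) => eval v q := by
  refine (injective_iff_map_eq_zero _).2 fun P hP => MvPolynomial.funext fun t => ?_
  obtain ⟨q, hq⟩ := exists_eval_eq_on_finset P.vars t
  calc eval t P = eval (fun v => eval v q) P :=
        (eval₂Hom_congr' rfl (fun v hv _ => hq v hv) rfl).symm
    _ = aeval (fun (v : σ → K) (q : MvPolynomial σ K) => eval v q) P q :=
        (aeval_pi_apply _ P q).symm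
    _ = eval t 0 := by rw [hP, Pi.zero_apply, map_zero]

theorem exists_algebraicIndependent_of_mk_eq_continuum {ι : Type} (hι : #ι = 𝔠) :
    ∃ u : (ℝ → ℝ) → ι → ℝ, AlgebraicIndependent ℝ u := by
  have hcard : #ι = #(MvPolynomial ℝ ℝ) := by
    rw [hι, cardinalMk_eq_max, Cardinal.mk_real, max_self,
      max_eq_left Cardinal.aleph0_le_continuum]
  obtain ⟨e⟩ := Cardinal.eq.1 hcard
  let reindex := AlgEquiv.piCongrLeft ℝ (fun _ : ι => ℝ) e.symm
  exact ⟨_, (algebraicIndependent_eval ℝ ℝ).map' (f := reindex.toAlgHom) reindex.injective⟩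

end Algebra

section SaturatedNonmeasurable

open Filter Topology

/-- A set is saturated nonmeasurable if neither it nor its complement has a measurable subset of
positive measure. -/
def IsSaturatedNonmeasurable {α : Type*} [MeasurableSpace α] (μ : Measure α) (N : Set α) : Prop :=
  ∀ M, MeasurableSet M → M ⊆ N ∨ M ⊆ Nᶜ → μ M = 0

theorem IsSaturatedNonmeasurable.measure_eq_zero {α : Type*} [MeasurableSpace α] {μ : Measure α}
    {N S : Set α} (hN : IsSaturatedNonmeasurable μ N) (h : NullMeasurableSet (N ∩ S) μ)
    (h' : NullMeasurableSet (Nᶜ ∩ S) μ) : μ S = 0 := by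
  have hpart : ∀ E, NullMeasurableSet E μ → E ⊆ N ∨ E ⊆ Nᶜ → μ E = 0 := by
    intro E hE hEN
    obtain ⟨M, hME, hM, hMae⟩ := hE.exists_measurable_subset_ae_eq
    rw [← measure_congr hMae]
    exact hN M hM (hEN.imp hME.trans hME.trans)
  rw [← Set.univ_inter S, ← Set.union_compl_self N, Set.union_inter_distrib_right]
  exact measure_union_null (hpart _ h (Or.inl Set.inter_subset_left))
    (hpart _ h' (Or.inr Set.inter_subset_left))

/-- By Steinhaus, a set of positive measure contains two points whose difference has image `1`, and
these have integer parts of opposite parity. -/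
theorem isSaturatedNonmeasurable_even_floor {G R : Type*} [AddGroup G] [TopologicalSpace G]
    [IsTopologicalAddGroup G] [LocallyCompactSpace G] [MeasurableSpace G] [BorelSpace G]
    (μ : Measure G) [μ.IsAddHaarMeasure] [μ.InnerRegular] [Ring R] [LinearOrder R]
    [IsStrictOrderedRing R] [FloorRing R] {l : G →+ R} (hl : ∃ᶠ x in 𝓝 0, l x = 1) :
    IsSaturatedNonmeasurable μ {x | Even ⌊l x⌋} := by
  intro M hM hparity
  by_contra hpos
  have hdiff := Measure.sub_mem_nhds_zero_of_addHaar_pos μ M hM (pos_iff_ne_zero.2 hpos)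
  obtain ⟨_, hl1, x, hx, y, hy, rfl⟩ := (hl.and_eventually hdiff).exists
  have hfloor : ⌊l x⌋ = ⌊l y⌋ + 1 := by
    rw [← Int.floor_add_one, ← hl1, map_sub, add_sub_cancel]
  have hflip : Even ⌊l x⌋ ↔ ¬Even ⌊l y⌋ := by rw [hfloor, Int.even_add_one]
  rcases hparity with h | h
  · exact hflip.1 (h hx) (h hy)
  · exact h hx (hflip.2 (h hy))

/-- A `ℚ`-linear map vanishing on `ℚ` with value `1` at `√2` takes the value `1` at every `√2 - q`
with `q` rational. -/
theorem exists_addMonoidHom_frequently_eq_one : ∃ l : ℝ →+ ℚ, ∃ᶠ x in 𝓝 0, l x = 1 := by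
  have hsqrt : √2 ∉ Submodule.span ℚ {(1 : ℝ)} := by
    rw [Submodule.mem_span_singleton]
    rintro ⟨q, hq⟩
    exact irrational_sqrt_two ⟨q, by rw [← hq, Rat.smul_one_eq_cast]⟩
  obtain ⟨f, hf, hle⟩ := Submodule.exists_le_ker_of_notMem hsqrt
  have hker (q : ℚ) : f q = 0 := by
    rw [← Rat.smul_one_eq_cast, map_smul, hle (Submodule.mem_span_singleton_self 1), smul_zero]
  refine ⟨((f √2)⁻¹ • f).toAddMonoidHom, ?_⟩
  have hdense : ∃ᶠ x in 𝓝 √2, x ∈ Set.range ((↑) : ℚ → ℝ) :=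
    mem_closure_iff_frequently.1 (Rat.denseRange_cast √2)
  have htendsto : Tendsto (fun x => √2 - x) (𝓝 √2) (𝓝 0) :=
    Continuous.tendsto' (by fun_prop) _ _ (sub_self _)
  refine htendsto.frequently (hdense.mono ?_)
  rintro _ ⟨q, rfl⟩
  simp [hker, hf]

theorem exists_isSaturatedNonmeasurable :
    ∃ N : Set ℝ, IsSaturatedNonmeasurable volume N := by
  obtain ⟨l, hl⟩ := exists_addMonoidHom_frequently_eq_one
  exact ⟨_, isSaturatedNonmeasurable_even_floor volume hl⟩

end SaturatedNonmeasurable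

section SteepIncrements

open Filter Topology
open scoped NNReal Pointwise

/-- A function with arbitrarily steep increments at arbitrarily small scales `h`, at every point
either to the right or to the left, with the same `h` for all points. -/
def HasSteepIncrements (φ : ℝ → ℝ) : Prop :=
  ∀ M : ℝ, ∃ᶠ h in 𝓝 0, ∀ x,
    M * |h| < |φ (x + h) - φ x| ∨ M * |h| < |φ (x - h) - φ x|

/-- A function which almost everywhere differs from any given continuous and almost everywhere
differentiable function; it can be modified freely on the graph of the former without affecting
superpositions with the latter. -/
def AvoidsAEDifferentiable (φ : ℝ → ℝ) : Prop :=
  ∀ g : ℝ → ℝ, Continuous g → (∀ᵐ x, DifferentiableAt ℝ g x) → ∀ᵐ x, φ x ≠ g x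

theorem AvoidsAEDifferentiable.add_const {φ : ℝ → ℝ} (hφ : AvoidsAEDifferentiable φ) (c : ℝ) :
    AvoidsAEDifferentiable fun x => φ x + c := by
  intro g hg hd
  filter_upwards [hφ (fun x => g x - c) (by fun_prop) (hd.mono fun x hx => hx.sub_const c)]
    with x hx hxg
  exact hx (eq_sub_of_add_eq hxg)

theorem eventually_exists_mem_add_mem_sub_mem {G : Type*} [AddCommGroup G] [TopologicalSpace G]
    [IsTopologicalAddGroup G] [LocallyCompactSpace G] [T2Space G] [MeasurableSpace G] [BorelSpace G]
    (μ : Measure G) [μ.IsAddHaarMeasure] [μ.InnerRegular] {E : Set G} (hE : MeasurableSet E)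
    (hpos : μ E ≠ 0) : ∀ᶠ h in 𝓝 (0 : G), ∃ x ∈ E, x + h ∈ E ∧ x - h ∈ E := by
  obtain ⟨K, hKE, hK, hKpos⟩ := hE.exists_lt_isCompact (pos_iff_ne_zero.2 hpos)
  have hsmall : ∀ᶠ h in 𝓝 (0 : G), μ ((h +ᵥ K) \ K) < μ K / 2 :=
    (tendsto_measure_vadd_sdiff_isCompact_isClosed hK hK.isClosed).eventually_lt_const
      (ENNReal.half_pos hKpos.ne')
  have hsmall_neg : ∀ᶠ h : G in 𝓝 0, μ (((-h : G) +ᵥ K) \ K) < μ K / 2 :=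
    (continuous_neg.tendsto' (0 : G) 0 neg_zero).eventually hsmall
  filter_upwards [hsmall, hsmall_neg] with h hh hh_neg
  by_contra! hcon
  have hcover : K ⊆ (-h +ᵥ ((h +ᵥ K) \ K)) ∪ (h +ᵥ ((-h +ᵥ K) \ K)) := by
    intro x hx
    by_cases hxh : x + h ∈ K
    · refine Or.inr (Set.mem_vadd_set_iff_neg_vadd_mem.2 ⟨?_, fun hx' => ?_⟩)
      · exact Set.vadd_mem_vadd_set hx
      · refine hcon x (hKE hx) (hKE hxh) (hKE ?_)
        rwa [sub_eq_neg_add]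
    · refine Or.inl (Set.mem_vadd_set_iff_neg_vadd_mem.2 ⟨?_, fun hx' => hxh ?_⟩)
      · rw [neg_neg]
        exact Set.vadd_mem_vadd_set hx
      · rwa [neg_neg, vadd_eq_add, add_comm] at hx'
  have hlt : μ K < μ K / 2 + μ K / 2 := by
    refine (measure_mono hcover).trans_lt ((measure_union_le _ _).trans_lt ?_)
    rw [measure_vadd, measure_vadd]
    exact ENNReal.add_lt_add hh hh_neg
  exact hlt.ne (ENNReal.add_halves _).symm

theorem HasSteepIncrements.volume_eq_zero_of_lipschitzOnWith {φ : ℝ → ℝ}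
    (hφ : HasSteepIncrements φ) {E : Set ℝ} (hE : MeasurableSet E) {K : ℝ≥0}
    (hK : LipschitzOnWith K φ E) : volume E = 0 := by
  by_contra hpos
  obtain ⟨h, hsteep, x, hx, hxadd, hxsub⟩ :=
    ((hφ K).and_eventually (eventually_exists_mem_add_mem_sub_mem volume hE hpos)).exists
  rcases hsteep x with hlt | hlt
  · have hle := hK.norm_sub_le hxadd hx
    rw [add_sub_cancel_left] at hle
    exact hlt.not_ge hle
  · have hle := hK.norm_sub_le hxsub hx
    rw [sub_sub_cancel_left, norm_neg] at hle
    exact hlt.not_ge hle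

theorem exists_measurable_cover_lipschitzOnWith {g : ℝ → ℝ} {s : Set ℝ} (hs : MeasurableSet s)
    (hg : ∀ x ∈ s, DifferentiableAt ℝ g x) :
    ∃ t : ℕ → Set ℝ, (∀ n, MeasurableSet (t n)) ∧ s ⊆ ⋃ n, t n ∧ (∀ n, t n ⊆ s) ∧
      ∀ n, ∃ K : ℝ≥0, LipschitzOnWith K g (t n) := by
  obtain ⟨t, A, ht, hst, hA, -⟩ := exists_closed_cover_approximatesLinearOn_of_hasFDerivWithinAt
    g s (fderiv ℝ g) (fun x hx => (hg x hx).hasFDerivAt.hasFDerivWithinAt) (fun _ => 1)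
    fun _ => one_ne_zero
  refine ⟨fun n => s ∩ t n, fun n => hs.inter (ht n).measurableSet, ?_,
    fun n => Set.inter_subset_left, fun n => ⟨_, lipschitzOnWith_iff_restrict.2 (hA n).lipschitz⟩⟩
  rw [← Set.inter_iUnion]
  exact Set.subset_inter subset_rfl hst

theorem HasSteepIncrements.avoidsAEDifferentiable {φ : ℝ → ℝ} (hφ : HasSteepIncrements φ)
    (hφm : Measurable φ) : AvoidsAEDifferentiable φ := by
  intro g hg hd
  let s := {x | φ x = g x} ∩ {x | DifferentiableAt ℝ g x}
  have hs : MeasurableSet s :=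
    (measurableSet_eq_fun hφm hg.measurable).inter (measurableSet_of_differentiableAt ℝ g)
  obtain ⟨t, ht, hcover, hts, hlip⟩ := exists_measurable_cover_lipschitzOnWith hs fun x hx => hx.2
  have hnull (n : ℕ) : volume (t n) = 0 := by
    obtain ⟨K, hK⟩ := hlip n
    exact hφ.volume_eq_zero_of_lipschitzOnWith (ht n) fun x hx y hy => by
      rw [(hts n hx).1, (hts n hy).1]
      exact hK hx hy
  have hs0 : volume s = 0 := measure_mono_null hcover (measure_iUnion_null hnull)
  filter_upwards [hd, measure_eq_zero_iff_ae_notMem.1 hs0] with x hx hxs hxg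
  exact hxs ⟨hxg, hx⟩

end SteepIncrements

section BinaryDigits

open Filter Topology

/-- The binary digit of `x` at the place `2 ^ (-k)`; the digit at `2 ^ 0` is the parity of the
integer part. -/
noncomputable def binaryDigit (k : ℕ) (x : ℝ) : ℤ :=
  ⌊2 ^ k * x⌋ % 2

/-- The sum of the binary expansion of `x` read with the ratio `r` in place of `1 / 2`, dropping the
digits in front of the one at `2 ^ 0`. For `1 / 2 < r < 1` it serves as a Borel function with steep
increments. -/
noncomputable def binaryDigitSeries (r x : ℝ) : ℝ :=
  ∑' k : ℕ, r ^ k * binaryDigit k x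

theorem binaryDigit_eq_zero_or_one (k : ℕ) (x : ℝ) : binaryDigit k x = 0 ∨ binaryDigit k x = 1 :=
  Int.emod_two_eq_zero_or_one _

theorem measurable_binaryDigit (k : ℕ) : Measurable (binaryDigit k) :=
  (measurable_from_top (f := fun m : ℤ => m % 2)).comp (measurable_id.const_mul (2 ^ k)).floor

theorem floor_two_pow_mul_add (k : ℕ) (x : ℝ) :
    ⌊2 ^ k * (x + (1 / 2) ^ k)⌋ = ⌊2 ^ k * x⌋ + 1 := by
  rw [mul_add, ← mul_pow]
  norm_num

theorem floor_two_pow_mul_eq_ediv (j i : ℕ) (x : ℝ) :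
    ⌊2 ^ j * x⌋ = ⌊2 ^ (j + (i + 1)) * x⌋ / 2 / 2 ^ i := by
  have hscale : 2 ^ j * x = 2 ^ (j + (i + 1)) * x / ((2 ^ (i + 1) : ℕ) : ℝ) := by
    push_cast
    field_simp
    ring
  rw [hscale, Int.floor_div_natCast, Int.ediv_ediv_of_nonneg zero_le_two, ← pow_succ']
  norm_cast

theorem binaryDigit_add_self (k : ℕ) (x : ℝ) :
    binaryDigit k (x + (1 / 2) ^ k) = 1 - binaryDigit k x := by
  unfold binaryDigit
  rw [floor_two_pow_mul_add]
  lia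

theorem binaryDigit_add_of_lt {j k : ℕ} (hjk : j < k) {x : ℝ} (hx : binaryDigit k x = 0) :
    binaryDigit j (x + (1 / 2) ^ k) = binaryDigit j x := by
  obtain ⟨i, rfl⟩ := Nat.exists_eq_add_of_lt hjk
  have hhalf : (⌊2 ^ (j + i + 1) * x⌋ + 1) / 2 = ⌊2 ^ (j + i + 1) * x⌋ / 2 := by
    unfold binaryDigit at hx
    lia
  unfold binaryDigit
  rw [floor_two_pow_mul_eq_ediv j i, floor_two_pow_mul_eq_ediv j i x, ← add_assoc,
    floor_two_pow_mul_add, hhalf]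

theorem binaryDigit_add_of_gt {j k : ℕ} (hkj : k < j) (x : ℝ) :
    binaryDigit j (x + (1 / 2) ^ k) = binaryDigit j x := by
  obtain ⟨i, rfl⟩ := Nat.exists_eq_add_of_lt hkj
  have hshift : (2 : ℝ) ^ (k + i + 1) * (x + (1 / 2) ^ k) =
      2 ^ (k + i + 1) * x + ((2 * 2 ^ i : ℤ) : ℝ) := by
    push_cast
    rw [mul_add, show (2 : ℝ) ^ (k + i + 1) = 2 ^ k * (2 * 2 ^ i) by ring,
      mul_right_comm _ _ ((1 / 2 : ℝ) ^ k), ← mul_pow]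
    norm_num
  unfold binaryDigit
  rw [hshift, Int.floor_add_intCast, Int.add_mul_emod_self_left]

variable {r : ℝ}

theorem measurable_binaryDigitSeries (r : ℝ) : Measurable (binaryDigitSeries r) :=
  Measurable.tsum fun k => (measurable_from_top.comp (measurable_binaryDigit k)).const_mul _

theorem summable_pow_mul_binaryDigit (hr0 : 0 ≤ r) (hr1 : r < 1) (x : ℝ) :
    Summable fun k : ℕ => r ^ k * binaryDigit k x := by
  refine (summable_geometric_of_lt_one hr0 hr1).of_norm_bounded fun k => ?_
  rcases binaryDigit_eq_zero_or_one k x with h | h <;> simp [h, abs_of_nonneg hr0, hr0]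

theorem binaryDigitSeries_add_sub (hr0 : 0 ≤ r) (hr1 : r < 1) {k : ℕ} {x : ℝ}
    (hx : binaryDigit k x = 0) :
    binaryDigitSeries r (x + (1 / 2) ^ k) - binaryDigitSeries r x = r ^ k := by
  unfold binaryDigitSeries
  rw [← (summable_pow_mul_binaryDigit hr0 hr1 _).tsum_sub (summable_pow_mul_binaryDigit hr0 hr1 _),
    tsum_eq_single k]
  · rw [binaryDigit_add_self, hx, sub_zero, Int.cast_one, Int.cast_zero, mul_one, mul_zero,
      sub_zero]
  · intro j hj
    rcases hj.lt_or_gt with h | h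
    · rw [binaryDigit_add_of_lt h hx, sub_self]
    · rw [binaryDigit_add_of_gt h, sub_self]

theorem abs_binaryDigitSeries_add_sub_or (hr0 : 0 ≤ r) (hr1 : r < 1) (k : ℕ) (x : ℝ) :
    |binaryDigitSeries r (x + (1 / 2) ^ k) - binaryDigitSeries r x| = r ^ k ∨
      |binaryDigitSeries r (x - (1 / 2) ^ k) - binaryDigitSeries r x| = r ^ k := by
  have hpow : 0 ≤ r ^ k := pow_nonneg hr0 k
  rcases binaryDigit_eq_zero_or_one k x with hx | hx
  · left
    rw [binaryDigitSeries_add_sub hr0 hr1 hx, abs_of_nonneg hpow]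
  · right
    have hflip := binaryDigit_add_self k (x - (1 / 2) ^ k)
    rw [sub_add_cancel, hx] at hflip
    have hincr := binaryDigitSeries_add_sub hr0 hr1 (k := k) (x := x - (1 / 2) ^ k) (by lia)
    rw [sub_add_cancel] at hincr
    rw [abs_sub_comm, hincr, abs_of_nonneg hpow]

theorem hasSteepIncrements_binaryDigitSeries (hr : 1 / 2 < r) (hr1 : r < 1) :
    HasSteepIncrements (binaryDigitSeries r) := by
  intro M
  have hscale : Tendsto (fun k : ℕ => (1 / 2 : ℝ) ^ k) atTop (𝓝 0) :=
    tendsto_pow_atTop_nhds_zero_of_lt_one (by norm_num) (by norm_num)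
  have hratio : Tendsto (fun k : ℕ => (2 * r) ^ k) atTop atTop :=
    tendsto_pow_atTop_atTop_of_one_lt (by linarith)
  refine hscale.frequently ((hratio.eventually_gt_atTop M).frequently.mono fun k hk x => ?_)
  have hlt : M * |(1 / 2 : ℝ) ^ k| < r ^ k := by
    calc M * |(1 / 2 : ℝ) ^ k| = M * (1 / 2) ^ k := by rw [abs_of_pos (by positivity)]
      _ < (2 * r) ^ k * (1 / 2) ^ k := by gcongr
      _ = r ^ k := by rw [← mul_pow]; ring
  exact (abs_binaryDigitSeries_add_sub_or (by linarith) hr1 k x).imp (fun h => hlt.trans_eq h.symm)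
    fun h => hlt.trans_eq h.symm

theorem exists_measurable_avoidsAEDifferentiable :
    ∃ φ : ℝ → ℝ, Measurable φ ∧ AvoidsAEDifferentiable φ :=
  ⟨binaryDigitSeries (3 / 4), measurable_binaryDigitSeries _,
    (hasSteepIncrements_binaryDigitSeries (by norm_num) (by norm_num)).avoidsAEDifferentiable
      (measurable_binaryDigitSeries _)⟩

end BinaryDigits

section Superposition

theorem measure_eq_zero_of_countable_sections {α β : Type*} [MeasurableSpace α] [MeasurableSpace β]
    {μ : Measure α} {ν : Measure β} [SFinite ν] [NullSingletonClass ν] {E : Set (α × β)}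
    (hE : NullMeasurableSet E (μ.prod ν)) (hsec : ∀ a, (Prod.mk a ⁻¹' E).Countable) :
    μ.prod ν E = 0 := by
  obtain ⟨M, hME, hM, hMae⟩ := hE.exists_measurable_subset_ae_eq
  rw [← measure_congr hMae, Measure.measure_prod_null hM]
  exact ae_of_all _ fun a => ((hsec a).mono (Set.preimage_mono hME)).measure_zero ν

theorem volume_graphOn_univ_eq_zero {φ : ℝ → ℝ} (hφ : Measurable φ) :
    volume (Set.univ.graphOn φ) = 0 := by
  have hgraph : Set.univ.graphOn φ = {p | p.2 = φ p.1} := by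
    ext p
    simp only [Set.mem_graphOn, Set.mem_univ, true_and, Set.mem_ofPred_eq, eq_comm]
  rw [hgraph]
  exact measure_eq_zero_of_countable_sections (measurableSet_graph hφ).nullMeasurableSet
    fun x => Set.countable_singleton (φ x)

theorem measure_graphOn_eq_zero_of_measure_eq_zero {α β : Type*} [MeasurableSpace α]
    [MeasurableSpace β] {μ : Measure α} {s : Set α} (hs : μ s = 0) (ν : Measure β) [SFinite ν]
    (f : α → β) : μ.prod ν (s.graphOn f) = 0 := by
  have hsub : s.graphOn f ⊆ s ×ˢ Set.univ := fun p hp => ⟨(Set.mem_graphOn.1 hp).1, trivial⟩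
  refine measure_mono_null hsub ?_
  rw [Measure.prod_prod, hs, zero_mul]

theorem weaklySupMeasurable_of_support_subset {F : ℝ × ℝ → ℝ} {S : Set (ℝ → ℝ)} (hS : S.Countable)
    (hF : Function.support F ⊆ ⋃ φ ∈ S, Set.univ.graphOn φ)
    (havoid : ∀ φ ∈ S, AvoidsAEDifferentiable φ) : WeaklySupMeasurable F := by
  intro g hg hd
  refine measurable_const.nullMeasurable.congr (f := fun _ => (0 : ℝ)) ?_
  filter_upwards [(ae_ball_iff hS).2 fun φ hφ => havoid φ hφ g hg hd] with x hx
  by_contra hne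
  obtain ⟨φ, hφ, hgraph⟩ := Set.mem_iUnion₂.1 (hF (Ne.symm hne))
  exact hx φ hφ (Set.mem_graphOn.1 hgraph).2

theorem LebesgueMeasurable.volume_support_eq_zero {F : ℝ × ℝ → ℝ} {S : Set (ℝ → ℝ)}
    (hF : LebesgueMeasurable F) (hS : S.Countable)
    (hsupp : Function.support F ⊆ ⋃ φ ∈ S, Set.univ.graphOn φ) :
    volume (Function.support F) = 0 := by
  refine measure_eq_zero_of_countable_sections (hF (measurableSet_singleton 0).compl) fun x =>
    (hS.image fun φ => φ x).mono fun y hy => ?_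
  simpa using hsupp hy

/-- The graph of `φ` over `N` and the graph of `ψ` off `N`, so that a function supported here is
tested on `N` and off `N` by its superpositions with `φ` and `ψ`, together with the part of the
graph of `f` that does not interfere with these two superpositions. -/
def splitGraphs (N : Set ℝ) (φ ψ f : ℝ → ℝ) : Set (ℝ × ℝ) :=
  N.graphOn φ ∪ Nᶜ.graphOn ψ ∪ Set.univ.graphOn f \ (Set.univ.graphOn φ ∪ Set.univ.graphOn ψ)

variable {N : Set ℝ} {φ ψ f h : ℝ → ℝ}

theorem splitGraphs_subset :
    splitGraphs N φ ψ f ⊆ ⋃ g ∈ ({φ, ψ, f} : Set (ℝ → ℝ)), Set.univ.graphOn g := by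
  have hgraph (g) (hg : g ∈ ({φ, ψ, f} : Set (ℝ → ℝ))) (s : Set ℝ) :
      s.graphOn g ⊆ ⋃ g ∈ ({φ, ψ, f} : Set (ℝ → ℝ)), Set.univ.graphOn g :=
    (Set.image_mono s.subset_univ).trans
      (Set.subset_biUnion_of_mem (u := fun g : ℝ → ℝ => Set.univ.graphOn g) hg)
  exact Set.union_subset (Set.union_subset (hgraph φ (by simp) N) (hgraph ψ (by simp) Nᶜ))
    (Set.sdiff_subset.trans (hgraph f (by simp) Set.univ))

theorem caratheodorySuperposition_splitGraphs_left (hne : ∀ x, φ x ≠ ψ x) :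
    caratheodorySuperposition ((splitGraphs N φ ψ f).indicator (h ∘ Prod.fst)) φ =
      N.indicator h := by
  ext x
  have hmem : (x, φ x) ∈ splitGraphs N φ ψ f ↔ x ∈ N := by
    simp [splitGraphs, (hne x).symm]
  by_cases hx : x ∈ N <;> simp [caratheodorySuperposition, hmem, hx]

theorem caratheodorySuperposition_splitGraphs_right (hne : ∀ x, φ x ≠ ψ x) :
    caratheodorySuperposition ((splitGraphs N φ ψ f).indicator (h ∘ Prod.fst)) ψ =
      Nᶜ.indicator h := by
  ext x
  have hmem : (x, ψ x) ∈ splitGraphs N φ ψ f ↔ x ∈ Nᶜ := by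
    simp [splitGraphs, hne x]
  by_cases hx : x ∈ N <;> simp [caratheodorySuperposition, hmem, hx]

theorem weaklySupMeasurable_indicator_splitGraphs (hφ : AvoidsAEDifferentiable φ)
    (hψ : AvoidsAEDifferentiable ψ) (hf : AvoidsAEDifferentiable f) :
    WeaklySupMeasurable ((splitGraphs N φ ψ f).indicator (h ∘ Prod.fst)) := by
  refine weaklySupMeasurable_of_support_subset (Set.toFinite {φ, ψ, f}).countable
    (Set.support_indicator_subset.trans splitGraphs_subset) ?_
  rintro g (rfl | rfl | rfl) <;> assumption

theorem not_supMeasurable_indicator_splitGraphs (hN : IsSaturatedNonmeasurable volume N)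
    (hφ : Measurable φ) (hψ : Measurable ψ) (hne : ∀ x, φ x ≠ ψ x)
    (hh : volume (Function.support h) ≠ 0) :
    ¬SupMeasurable ((splitGraphs N φ ψ f).indicator (h ∘ Prod.fst)) := by
  intro hF
  have hon := hF φ hφ.nullMeasurable (measurableSet_singleton 0).compl
  have hoff := hF ψ hψ.nullMeasurable (measurableSet_singleton 0).compl
  rw [caratheodorySuperposition_splitGraphs_left hne] at hon
  rw [caratheodorySuperposition_splitGraphs_right hne] at hoff
  exact hh (hN.measure_eq_zero (Set.support_indicator (s := N) (f := h) ▸ hon)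
    (Set.support_indicator (s := Nᶜ) (f := h) ▸ hoff))

theorem not_lebesgueMeasurable_indicator_splitGraphs (hφ : Measurable φ) (hψ : Measurable ψ)
    (hh : volume ((Function.support h).graphOn f) ≠ 0) :
    ¬LebesgueMeasurable ((splitGraphs N φ ψ f).indicator (h ∘ Prod.fst)) := by
  intro hF
  have hsupp := hF.volume_support_eq_zero (Set.toFinite {φ, ψ, f}).countable
    (Set.support_indicator_subset.trans splitGraphs_subset)
  refine hh (measure_mono_null ?_ (measure_union_null (measure_union_null
    (volume_graphOn_univ_eq_zero hφ) (volume_graphOn_univ_eq_zero hψ)) hsupp))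
  intro p hp
  by_cases hgraph : p ∈ Set.univ.graphOn φ ∪ Set.univ.graphOn ψ
  · exact Or.inl hgraph
  · have hT : p ∈ splitGraphs N φ ψ f :=
      Or.inr ⟨Set.image_mono (Set.subset_univ _) hp, hgraph⟩
    right
    rw [Set.support_indicator]
    exact ⟨hT, (Set.mem_graphOn.1 hp).1⟩

end Superposition

theorem ConditionA.exists_fibers (hA : ConditionA) :
    ∃ (ι : Type) (f : ℝ → ℝ) (c : ℝ → ι), #ι = 𝔠 ∧ AvoidsAEDifferentiable f ∧
      ∀ i, 0 < volume ((c ⁻¹' {i}).graphOn f) := by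
  obtain ⟨f, ι, G, hι, hdisj, hunion, hpos, hnull⟩ := hA
  have hgraph (i : ι) {p : ℝ × ℝ} (hp : p ∈ G i) : f p.1 = p.2 :=
    (hunion.subset (Set.mem_iUnion_of_mem i hp)).symm
  have hcover (x : ℝ) : ∃ i, (x, f x) ∈ G i := Set.mem_iUnion.1 (hunion.superset rfl)
  choose c hc using hcover
  refine ⟨ι, f, c, hι, fun g hg _ => measure_eq_zero_iff_ae_notMem.1 (hnull g hg), fun i =>
    (hpos i).trans_le (measure_mono fun p hp => Set.mem_graphOn.2 ⟨?_, hgraph i hp⟩)⟩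
  have hp' : p ∈ G (c p.1) := by
    rw [show p = (p.1, f p.1) from Prod.ext rfl (hgraph i hp).symm]
    exact hc p.1
  exact hdisj.eq (Set.not_disjoint_iff.2 ⟨p, hp', hp⟩)

theorem mainTheorem3_general {ι : Type} (hι : #ι = 𝔠) {f : ℝ → ℝ} {c : ℝ → ι}
    (hf : AvoidsAEDifferentiable f) (hc : ∀ i, 0 < volume ((c ⁻¹' {i}).graphOn f)) :
    StronglyAlgebrable ℝ ((2 : Cardinal) ^ 𝔠)
      {F : ℝ × ℝ → ℝ |
        WeaklySupMeasurable F ∧ ¬ SupMeasurable F ∧ ¬ LebesgueMeasurable F} := by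
  obtain ⟨N, hN⟩ := exists_isSaturatedNonmeasurable
  obtain ⟨φ, hφm, hφ⟩ := exists_measurable_avoidsAEDifferentiable
  obtain ⟨u, hu⟩ := exists_algebraicIndependent_of_mk_eq_continuum hι
  let T := splitGraphs N φ (fun x => φ x + 1) f
  have hzero : SupMeasurable 0 := fun _ _ => measurable_const.nullMeasurable
  have hcard : #(ℝ → ℝ) = 2 ^ 𝔠 := by
    rw [← Cardinal.power_def, Cardinal.mk_real, Cardinal.power_self_eq Cardinal.aleph0_le_continuum]
  rw [← hcard]
  refine .of_aeval_mem (fun h0 => h0.2.1 hzero)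
    (fun v => T.indicator (u v ∘ c ∘ Prod.fst)) fun P hP hP0 => ?_
  have haeval : MvPolynomial.aeval (fun v => T.indicator (u v ∘ c ∘ Prod.fst)) P =
      T.indicator ((MvPolynomial.aeval u P ∘ c) ∘ Prod.fst) := by
    rw [aeval_indicator T _ hP0, aeval_pi_comp, Function.comp_assoc]
  rw [haeval]
  obtain ⟨i, hi⟩ := Function.ne_iff.1 ((map_ne_zero_iff _ hu).2 hP)
  have hfiber : c ⁻¹' {i} ⊆ Function.support (MvPolynomial.aeval u P ∘ c) := by
    rintro x rfl
    exact hi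
  have hpos := (hc i).trans_le (measure_mono (Set.image_mono hfiber))
  have hψm : Measurable fun x => φ x + 1 := hφm.add_const 1
  have hne (x : ℝ) : φ x ≠ φ x + 1 := (lt_add_one _).ne
  have hsupp := fun h0 => hpos.ne' (measure_graphOn_eq_zero_of_measure_eq_zero h0 volume f)
  exact ⟨weaklySupMeasurable_indicator_splitGraphs hφ (hφ.add_const 1) hf,
    not_supMeasurable_indicator_splitGraphs hN hφm hψm hne hsupp,
    not_lebesgueMeasurable_indicator_splitGraphs hφm hψm hpos.ne'⟩

theorem mainTheorem3 (hA : ConditionA) :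
    StronglyAlgebrable ℝ ((2 : Cardinal) ^ 𝔠)
      {F : ℝ × ℝ → ℝ |
        WeaklySupMeasurable F ∧ ¬ SupMeasurable F ∧ ¬ LebesgueMeasurable F} := by
  obtain ⟨ι, f, c, hι, hf, hc⟩ := hA.exists_fibers
  exact mainTheorem3_general hι hf hc
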